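/- For integers $k\ge 1$ and $n\ge 0$, let $p_{-k}(n)$ denote the number of $k$-colored partitions of $n$, that is, of partitions of $n$ in which each part carries one of $k$ colors (multisets of colored positive integers with sum $n$); equivalently, $\sum_{n\ge 0}p_{-k}(n)q^n=\prod_{m\ge 1}(1-q^m)^{-k}$. Then for all integers $r\ge 0$ and $n\ge 0$, the following congruences hold modulo $25$: $$p_{-(25r+16)}(25n+19)\equiv p_{-(25r+16)}(25n+24)\equiv 0,$$ $$p_{-(25r+21)}(25n+9)\equiv p_{-(25r+21)}(25n+14)\equiv p_{-(25r+21)}(25n+19)\equiv p_{-(25r+21)}(25n+24)\equiv 0,$$ $$p_{-(25r+22)}(25n+8)\equiv p_{-(25r+22)}(25n+13)\equiv p_{-(25r+22)}(25n+18)\equiv p_{-(25r+22)}(25n+23)\equiv 0.$$ -/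

import Mathlib

/-- A `k`-colored partition of `n`: a finite multiset of positive integers (the parts), each part
carrying one of `k` colors, with the parts adding up to `n`. As for ordinary partitions the order
of the parts is irrelevant, and a part in a given color may be repeated. -/
@[ext]
structure ColoredPartition (k n : ℕ) where
  /-- the colored parts: pairs (size, color), with multiplicity -/
  parts : Multiset (ℕ × Fin k)
  parts_pos : ∀ x ∈ parts, 0 < x.1
  parts_sum : (parts.map Prod.fst).sum = n

/-- There are only finitely many `k`-colored partitions of `n`, so they can be counted. -/
instance ColoredPartition.instFinite (k n : ℕ) : Finite (ColoredPartition k n) := by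
  classical
  let B : Multiset (ℕ × Fin k) := n • (Finset.range (n + 1) ×ˢ (Finset.univ : Finset (Fin k))).val
  have hle : ∀ P : ColoredPartition k n, P.parts ≤ B := by
    intro P
    rw [Multiset.le_iff_count]
    intro x
    by_cases hx : x ∈ P.parts
    · have hx1 : x.1 ≤ n := by
        rw [← P.parts_sum]
        exact Multiset.le_sum_of_mem (Multiset.mem_map_of_mem _ hx)
      have hcard : P.parts.card ≤ n := by
        have h := Multiset.card_nsmul_le_sum (s := P.parts.map Prod.fst) (a := 1) (by
          intro y hy
          obtain ⟨z, hz, rfl⟩ := Multiset.mem_map.1 hy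
          exact P.parts_pos z hz)
        rw [P.parts_sum] at h
        simpa using h
      have hmem : x ∈ (Finset.range (n + 1) ×ˢ (Finset.univ : Finset (Fin k))).val := by
        rw [Finset.mem_val, Finset.mem_product]
        exact ⟨Finset.mem_range.2 (Nat.lt_succ_of_le hx1), Finset.mem_univ _⟩
      have h1 : 1 ≤ Multiset.count x
          (Finset.range (n + 1) ×ˢ (Finset.univ : Finset (Fin k))).val :=
        Multiset.one_le_count_iff_mem.2 hmem
      calc Multiset.count x P.parts ≤ n := (Multiset.count_le_card _ _).trans hcard
        _ ≤ Multiset.count x B := by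
          rw [Multiset.count_nsmul]
          exact Nat.le_mul_of_pos_right n h1
    · rw [Multiset.count_eq_zero_of_notMem hx]
      exact Nat.zero_le _
  exact Finite.of_injective (fun P => (⟨P.parts, hle P⟩ : Set.Iic B))
    (fun P Q h => ColoredPartition.ext (congrArg Subtype.val h))

/-- `coloredPartitionCount k n` is the number of `k`-colored partitions of `n`, usually written
`p_{-k}(n)`; it is the coefficient of `q ^ n` in `∏_{m ≥ 1} (1 - q ^ m) ^ (-k)`. -/
noncomputable def coloredPartitionCount (k n : ℕ) : ℕ :=
  Nat.card (ColoredPartition k n)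

/-! Let `E = ∏ (1 - q^m)`. If `k + l = 25 s`, then `E^(-k) = E^l * h^25` with `h = E^(-s)`; the
three families have `l = 9, 4, 3`. Modulo 25, `h^25` is a series in `q^5`; modulo 5, it is a series
in `q^25`. So only the exponents in `E^l` matter. Euler's pentagonal theorem gives `E = u + v`, with
exponents 0, 2 mod 5 in `u` and 1 mod 25 in `v`. Jacobi's identity gives `E^3 = a + b + 5c`, with
exponents 0 mod 5, 1 mod 5 and 3 mod 25. For `l = 3` the class 3 mod 5 comes only from `5c`; for `l
= 4` the class 4 comes only from `5vc`. For `l = 9` it comes modulo 25 from `15 * (2ab) * c`, and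
modulo 5 the series `2ab` is the class 1 part of `E^6 ≡ E(q) E(q^5)`, namely `v * E(q^5)`, with
exponents 1, 6, 11 mod 25. -/

open PowerSeries in
/-- The generating function of the partition numbers. -/
noncomputable def partitionSeries : ℤ⟦X⟧ :=
  PowerSeries.mk fun n ↦ (Fintype.card n.Partition : ℤ)

open PowerSeries PowerSeries.WithPiTopology in
/-- The Euler product is the inverse of the generating function of the partition numbers. -/
theorem partitionSeries_mul_pentagonalSeries : partitionSeries * pentagonalSeries ℤ = 1 := by
  have h1 := Nat.Partition.hasProd_powerSeriesMk_card_restricted ℤ (fun _ ↦ True)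
  have h2 := hasProd_one_sub_X_pow ℤ
  have h3 := h1.mul h2
  have h4 : (fun i : ℕ ↦ (if True then ∑' j : ℕ, (X : ℤ⟦X⟧) ^ ((i + 1) * j) else 1) *
      (1 - X ^ (i + 1))) = fun _ ↦ 1 := by
    funext i
    rw [if_pos trivial]
    simp_rw [pow_mul]
    exact tsum_pow_mul_one_sub_of_constantCoeff_eq_zero (by simp)
  rw [h4] at h3
  have h5 := h3.unique hasProd_one
  rw [← h5]
  congr 1
  ext n
  simp [partitionSeries, Nat.Partition.restricted, Finset.card_univ]

/-! ### Colored partitions: splitting off one color -/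

namespace ColoredPartition

/-- The sizes of the parts whose color is the first one. -/
def firstParts {k : ℕ} (s : Multiset (ℕ × Fin (k + 1))) : Multiset ℕ :=
  s.filterMap fun x ↦ Fin.cases (some x.1) (fun _ ↦ none) x.2

/-- The parts whose color is not the first one. -/
def otherParts {k : ℕ} (s : Multiset (ℕ × Fin (k + 1))) : Multiset (ℕ × Fin k) :=
  s.filterMap fun x ↦ Fin.cases none (fun c ↦ some (x.1, c)) x.2

/-- Recombine the parts of the first color with those of the others. -/
def joinParts {k : ℕ} (a : Multiset ℕ) (b : Multiset (ℕ × Fin k)) :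
    Multiset (ℕ × Fin (k + 1)) :=
  a.map (fun x ↦ (x, 0)) + b.map (fun x ↦ (x.1, x.2.succ))

variable {k n : ℕ}

theorem joinParts_firstParts_otherParts (s : Multiset (ℕ × Fin (k + 1))) :
    joinParts (firstParts s) (otherParts s) = s := by
  induction s using Multiset.induction with
  | empty => simp [joinParts, firstParts, otherParts]
  | cons x s ih =>
    obtain ⟨x, c⟩ := x
    conv_rhs => rw [← ih]
    induction c using Fin.cases <;>
      simp [joinParts, firstParts, otherParts, Multiset.filterMap_cons]

theorem firstParts_joinParts (a : Multiset ℕ) (b : Multiset (ℕ × Fin k)) :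
    firstParts (joinParts a b) = a := by
  induction b using Multiset.induction with
  | empty => simp [firstParts, joinParts, Multiset.filterMap_map, Function.comp_def]
  | cons x b ih => simpa [firstParts, joinParts, Multiset.filterMap_cons] using ih

theorem otherParts_joinParts (a : Multiset ℕ) (b : Multiset (ℕ × Fin k)) :
    otherParts (joinParts a b) = b := by
  induction a using Multiset.induction with
  | empty => simp [otherParts, joinParts, Multiset.filterMap_map, Function.comp_def]
  | cons x a ih => simpa [otherParts, joinParts, Multiset.filterMap_cons] using ih

theorem sum_joinParts (a : Multiset ℕ) (b : Multiset (ℕ × Fin k)) :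
    ((joinParts a b).map Prod.fst).sum = a.sum + (b.map Prod.fst).sum := by
  simp [joinParts]

theorem forall_joinParts (a : Multiset ℕ) (b : Multiset (ℕ × Fin k)) :
    (∀ x ∈ joinParts a b, 0 < x.1) ↔ (∀ x ∈ a, 0 < x) ∧ ∀ x ∈ b, 0 < x.1 := by
  simp only [joinParts, Multiset.mem_add, Multiset.mem_map, or_imp, forall_and]
  aesop

/-- Merge an ordinary partition, as parts of a new color, with a colored partition. -/
def join (k n : ℕ) (x : Σ p : Finset.HasAntidiagonal.antidiagonal n,
    Nat.Partition p.1.1 × ColoredPartition k p.1.2) : ColoredPartition (k + 1) n where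
  parts := joinParts x.2.1.parts x.2.2.parts
  parts_pos := (forall_joinParts _ _).2 ⟨fun _ h ↦ x.2.1.parts_pos h, x.2.2.parts_pos⟩
  parts_sum := by
    rw [sum_joinParts, x.2.1.parts_sum, x.2.2.parts_sum]
    exact Finset.HasAntidiagonal.mem_antidiagonal.1 x.1.2

theorem join_bijective (k n : ℕ) : Function.Bijective (join k n) := by
  constructor
  · rintro ⟨⟨⟨i, j⟩, hp⟩, ⟨a, ha, hi⟩, ⟨b, hb, hj⟩⟩
      ⟨⟨⟨i', j'⟩, hp'⟩, ⟨a', ha', hi'⟩, ⟨b', hb', hj'⟩⟩ h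
    dsimp only at hi hj hi' hj'
    have h0 : joinParts a b = joinParts a' b' := congrArg ColoredPartition.parts h
    obtain rfl : a = a' := by
      rw [← firstParts_joinParts a b, h0, firstParts_joinParts]
    obtain rfl : b = b' := by
      rw [← otherParts_joinParts a b, h0, otherParts_joinParts]
    subst hi hj hi' hj'
    rfl
  · rintro ⟨s, hs, rfl⟩
    have h0 := joinParts_firstParts_otherParts s
    have h1 := (forall_joinParts _ _).1 (h0.symm ▸ hs)
    refine ⟨⟨⟨((firstParts s).sum, ((otherParts s).map Prod.fst).sum), ?_⟩,
      ⟨firstParts s, fun {x} h ↦ h1.1 x h, rfl⟩, ⟨otherParts s, h1.2, rfl⟩⟩, ?_⟩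
    · rw [Finset.HasAntidiagonal.mem_antidiagonal, ← sum_joinParts, h0]
    · exact ColoredPartition.ext h0

end ColoredPartition

theorem coloredPartitionCount_succ (k n : ℕ) :
    coloredPartitionCount (k + 1) n = ∑ p ∈ Finset.HasAntidiagonal.antidiagonal n,
      Fintype.card (Nat.Partition p.1) * coloredPartitionCount k p.2 := by
  rw [coloredPartitionCount, ← Nat.card_congr (Equiv.ofBijective _
    (ColoredPartition.join_bijective k n)), Nat.card_sigma,
    ← Finset.sum_coe_sort (Finset.HasAntidiagonal.antidiagonal n)]
  simp [Nat.card_prod, coloredPartitionCount]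

theorem coloredPartitionCount_zero (n : ℕ) :
    coloredPartitionCount 0 n = if n = 0 then 1 else 0 := by
  have hp (P : ColoredPartition 0 n) : P.parts = 0 :=
    Multiset.eq_zero_of_forall_notMem fun x _ ↦ x.2.elim0
  split_ifs with h
  · subst h
    have : Unique (ColoredPartition 0 0) :=
      { default := ⟨0, by simp, by simp⟩
        uniq := fun P ↦ ColoredPartition.ext (hp P) }
    exact Nat.card_unique
  · have : IsEmpty (ColoredPartition 0 n) :=
      ⟨fun P ↦ h (by simpa [hp P] using P.parts_sum.symm)⟩
    exact Nat.card_of_isEmpty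

/-- The generating function of the `k`-colored partition numbers. -/
theorem coeff_partitionSeries_pow (k n : ℕ) :
    (partitionSeries ^ k).coeff n = (coloredPartitionCount k n : ℤ) := by
  induction k generalizing n with
  | zero => simp [coloredPartitionCount_zero, PowerSeries.coeff_one]
  | succ k ih =>
    rw [pow_succ', PowerSeries.coeff_mul, coloredPartitionCount_succ]
    simp only [ih]
    simp [partitionSeries]

/-! ### Gaussian binomials and the finite `q`-binomial theorem -/

section QBinomial

variable {R : Type*} [CommRing R]

/-- The Gaussian binomial coefficient `[n, k]` at `q`, by Pascal's rule. -/
def qBinomial (q : R) : ℕ → ℕ → R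
  | _, 0 => 1
  | 0, _ + 1 => 0
  | n + 1, k + 1 => qBinomial q n k + q ^ (k + 1) * qBinomial q n (k + 1)

/-- The finite product `(1 - q) (1 - q ^ 2) ⋯ (1 - q ^ n)`. -/
def qFactorial (q : R) (n : ℕ) : R := ∏ i ∈ Finset.range n, (1 - q ^ (i + 1))

theorem qFactorial_succ (q : R) (n : ℕ) :
    qFactorial q (n + 1) = qFactorial q n * (1 - q ^ (n + 1)) :=
  Finset.prod_range_succ _ _

@[simp]
theorem qBinomial_zero_right (q : R) (n : ℕ) : qBinomial q n 0 = 1 := by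
  cases n <;> rfl

theorem qBinomial_succ_succ (q : R) (n k : ℕ) :
    qBinomial q (n + 1) (k + 1) = qBinomial q n k + q ^ (k + 1) * qBinomial q n (k + 1) := rfl

theorem qBinomial_eq_zero (q : R) {n k : ℕ} (h : n < k) : qBinomial q n k = 0 := by
  induction n generalizing k with
  | zero => cases k with
    | zero => omega
    | succ k => rfl
  | succ n ih => cases k with
    | zero => omega
    | succ k => rw [qBinomial_succ_succ, ih (by omega), ih (by omega)]; simp

@[simp]
theorem qBinomial_self (q : R) (n : ℕ) : qBinomial q n n = 1 := by
  induction n with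
  | zero => rfl
  | succ n ih => rw [qBinomial_succ_succ, ih, qBinomial_eq_zero q (Nat.lt_succ_self n)]; simp

theorem qBinomial_mul_qFactorial (q : R) (a b : ℕ) :
    qBinomial q (a + b) a * (qFactorial q a * qFactorial q b) = qFactorial q (a + b) := by
  obtain ⟨n, hn⟩ : ∃ n, n = a + b := ⟨_, rfl⟩
  induction n generalizing a b with
  | zero =>
    obtain ⟨rfl, rfl⟩ : a = 0 ∧ b = 0 := by omega
    simp [qFactorial]
  | succ n ih =>
    cases a with
    | zero => simp [qFactorial]
    | succ a =>
      cases b with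
      | zero => simp [qFactorial]
      | succ b =>
        have h1 := ih a (b + 1) (by omega)
        have h2 := ih (a + 1) b (by omega)
        rw [show a + 1 + (b + 1) = (a + (b + 1)) + 1 by ring, qBinomial_succ_succ, add_mul,
          qFactorial_succ q (a + (b + 1))]
        rw [show a + 1 + b = a + (b + 1) by ring] at h2
        rw [qFactorial_succ q a] at h2 ⊢
        rw [qFactorial_succ q b] at h1 ⊢
        -- Uses `1 - q^(a+b+2) = (1 - q^(a+1)) + q^(a+1) * (1 - q^(b+1))`.
        linear_combination (1 - q ^ (a + 1)) * h1 + q ^ (a + 1) * (1 - q ^ (b + 1)) * h2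

/-- The homogeneous form of the `q`-binomial theorem. -/
theorem prod_add_mul_pow_eq_sum_qBinomial (q x y : R) (n : ℕ) :
    ∏ i ∈ Finset.range n, (y + x * q ^ i) =
      ∑ k ∈ Finset.range (n + 1), q ^ (k.choose 2) * qBinomial q n k * x ^ k * y ^ (n - k) := by
  induction n generalizing x with
  | zero => simp
  | succ n ih =>
    -- Without the factor `i = 0`, the product is the shorter one at `x * q`; hence the induction
    -- over all `x`.
    rw [Finset.prod_range_succ']
    have h : ∏ i ∈ Finset.range n, (y + x * q ^ (i + 1)) =
        ∏ i ∈ Finset.range n, (y + (x * q) * q ^ i) :=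
      Finset.prod_congr rfl fun i _ ↦ by ring
    rw [h, ih, pow_zero, mul_one, mul_add, mul_comm _ y, Finset.mul_sum, Finset.sum_mul,
      Finset.sum_range_succ' _ (n + 1), Finset.sum_range_succ']
    have h1 : ∑ k ∈ Finset.range n, y * (q ^ ((k + 1).choose 2) * qBinomial q n (k + 1) *
          (x * q) ^ (k + 1) * y ^ (n - (k + 1))) =
        ∑ k ∈ Finset.range (n + 1), q ^ ((k + 1).choose 2) * (q ^ (k + 1) *
          qBinomial q n (k + 1)) * x ^ (k + 1) * y ^ (n - k) := by
      rw [Finset.sum_range_succ, qBinomial_eq_zero q (Nat.lt_succ_self n)]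
      simp only [mul_zero, zero_mul, add_zero]
      refine Finset.sum_congr rfl fun k hk ↦ ?_
      rw [Finset.mem_range] at hk
      rw [show n - k = (n - (k + 1)) + 1 by omega]
      ring
    have h2 : ∀ k, q ^ ((k + 1).choose 2) = q ^ (k.choose 2) * q ^ k := fun k ↦ by
      rw [← pow_add, Nat.choose_succ_succ' k 1, Nat.choose_one_right, add_comm]
    rw [h1, add_right_comm, ← Finset.sum_add_distrib]
    congr 1
    · refine Finset.sum_congr rfl fun k _ ↦ ?_
      rw [qBinomial_succ_succ, Nat.add_sub_add_right, h2]
      ring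
    · simp; ring

end QBinomial

/-! ### Jacobi's identity for `E^3` -/

section JacobiTriangular

/-- Each factor is `-q^i * (1 - q^(n-i))`. -/
theorem prod_pow_sub_pow {R : Type*} [CommRing R] (q : R) (n : ℕ) :
    ∏ i ∈ Finset.range n, (q ^ n - q ^ i) = (-1) ^ n * q ^ (n.choose 2) * qFactorial q n := by
  induction n with
  | zero => simp [qFactorial]
  | succ n ih =>
    have h : ∏ i ∈ Finset.range n, (q ^ (n + 1) - q ^ (i + 1)) =
        ∏ i ∈ Finset.range n, q * (q ^ n - q ^ i) :=
      Finset.prod_congr rfl fun i _ ↦ by ring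
    rw [Finset.prod_range_succ', h, Finset.prod_mul_distrib, ih, qFactorial_succ,
      Nat.choose_succ_succ' n 1, Nat.choose_one_right]
    simp
    ring

open Polynomial in
/-- A finite form of Jacobi's identity: the derivative at `z = 1` of the `q`-binomial theorem. -/
theorem sum_qBinomial_derivative {R : Type*} [CommRing R] (q : R) (n : ℕ) :
    ∑ k ∈ Finset.range (2 * n + 2), (-1) ^ k * k * q ^ (k.choose 2 + n * (2 * n + 1 - k)) *
        qBinomial q (2 * n + 1) k =
      (-1) ^ (n + 1) * q ^ (n.choose 2 + n * (n + 1)) * qFactorial q n ^ 2 := by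
  have h := prod_add_mul_pow_eq_sum_qBinomial (C q : R[X]) (-X) (C q ^ n) (2 * n + 1)
  have hl : ∏ i ∈ Finset.range (2 * n + 1), ((C q : R[X]) ^ n + -X * C q ^ i) =
      (∏ i ∈ Finset.range n, (C q ^ n + -X * C q ^ i)) *
      ((∏ i ∈ Finset.range n, (C q ^ n + -X * C q ^ (n + (i + 1)))) *
        (C q ^ n + -X * C q ^ (n + 0))) := by
    rw [show 2 * n + 1 = n + (n + 1) by ring, Finset.prod_range_add, Finset.prod_range_succ']
  rw [hl] at h
  -- The middle factor `q^n * (1 - X)` vanishes at `X = 1`, so only the term that differentiates it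
  -- survives.
  have hL : ∀ A B : R[X], derivative (A * (B * (C q ^ n + -X * C q ^ (n + 0)))) =
      derivative (A * B * C q ^ n) * (1 - X) - A * B * C q ^ n := by
    intro A B
    rw [show A * (B * (C q ^ n + -X * C q ^ (n + 0))) = A * B * C q ^ n * (1 - X) by ring,
      derivative_mul (f := A * B * C q ^ n)]
    simp
    ring
  have hC : ∀ m k, qBinomial (C q : R[X]) m k = C (qBinomial q m k) := by
    intro m
    induction m with
    | zero => rintro (_ | k) <;> simp [qBinomial]
    | succ m ih => rintro (_ | k) <;> simp [qBinomial_succ_succ, ih]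
  replace h := congrArg (fun f ↦ (derivative f).eval 1) h
  rw [hL] at h
  simp only [hC] at h
  have hA := prod_pow_sub_pow q n
  have hB : ∏ i ∈ Finset.range n, (q ^ n + -(q ^ (n + (i + 1)))) =
      q ^ (n * n) * qFactorial q n := by
    have h1 : q ^ (n * n) = ∏ _i ∈ Finset.range n, q ^ n := by simp [pow_mul]
    rw [qFactorial, h1, ← Finset.prod_mul_distrib]
    exact Finset.prod_congr rfl fun i _ ↦ by ring
  simp only [sub_eq_add_neg] at hA
  have hR : ∀ k, (derivative (C q ^ (k.choose 2) * C (qBinomial q (2 * n + 1) k) * (-X) ^ k *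
      (C q ^ n) ^ (2 * n + 1 - k))).eval 1 =
      (-1) ^ k * k * q ^ (k.choose 2 + n * (2 * n + 1 - k)) * qBinomial q (2 * n + 1) k := by
    intro k
    rw [show C q ^ (k.choose 2) * C (qBinomial q (2 * n + 1) k) * (-X) ^ k *
      (C q ^ n) ^ (2 * n + 1 - k) = C (q ^ (k.choose 2) * qBinomial q (2 * n + 1) k * (-1) ^ k *
      (q ^ n) ^ (2 * n + 1 - k)) * X ^ k by
        rw [neg_pow]; simp only [C_mul, C_pow, C_neg, C_1]; ring]
    rw [derivative_C_mul_X_pow, ← pow_mul]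
    simp
    ring
  rw [derivative_sum, eval_finsetSum] at h
  simp only [hR] at h
  rw [← h]
  simp only [eval_sub, eval_mul, eval_prod, eval_add, eval_pow, eval_C, eval_neg, eval_X,
    eval_one, neg_mul, one_mul, sub_self, mul_zero]
  rw [hA, hB]
  ring

theorem two_mul_choose_two (m : ℕ) : 2 * (m.choose 2 : ℤ) = m * (m - 1) := by
  induction m with
  | zero => simp
  | succ m ih =>
    rw [Nat.choose_succ_succ' m 1, Nat.choose_one_right]
    push_cast
    linarith

open PowerSeries

/-- In the finite Jacobi identity the terms `k = n + 1 + j` and `k = n - j` carry the same power of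
`X` and opposite signs; pair them and cancel the common monomial. -/
theorem qFactorial_sq_eq_sum (n : ℕ) :
    qFactorial (X : ℤ⟦X⟧) n ^ 2 = ∑ j ∈ Finset.range (n + 1), (-1) ^ j * X ^ ((j + 1).choose 2) *
      (((n + 1 + j : ℕ) : ℤ⟦X⟧) * qBinomial X (2 * n + 1) (n + 1 + j) -
        ((n - j : ℕ) : ℤ⟦X⟧) * qBinomial X (2 * n + 1) (n - j)) := by
  have h := sum_qBinomial_derivative (X : ℤ⟦X⟧) n
  rw [show 2 * n + 2 = (n + 1) + (n + 1) by ring, Finset.sum_range_add,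
    ← Finset.sum_range_reflect, ← Finset.sum_add_distrib] at h
  have hX : ((-1) ^ (n + 1) * X ^ (n.choose 2 + n * (n + 1)) : ℤ⟦X⟧) ≠ 0 := by
    simp
  refine mul_left_cancel₀ hX ?_
  rw [← h, Finset.mul_sum]
  refine Finset.sum_congr rfl fun j hj ↦ ?_
  obtain ⟨d, rfl⟩ := Nat.exists_eq_add_of_le (Nat.lt_succ_iff.1 (Finset.mem_range.1 hj))
  have c1 := two_mul_choose_two d
  have c2 := two_mul_choose_two (j + d)
  have c3 := two_mul_choose_two (j + 1)
  have c4 := two_mul_choose_two (j + d + 1 + j)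
  have e1 : d.choose 2 + (j + d) * (2 * (j + d) + 1 - d) =
      (j + d).choose 2 + (j + d) * (j + d + 1) + (j + 1).choose 2 := by
    rw [show 2 * (j + d) + 1 - d = 2 * j + d + 1 by omega]
    zify
    push_cast at c1 c2 c3
    linarith
  have e2 : (j + d + 1 + j).choose 2 + (j + d) * (2 * (j + d) + 1 - (j + d + 1 + j)) =
      (j + d).choose 2 + (j + d) * (j + d + 1) + (j + 1).choose 2 := by
    rw [show 2 * (j + d) + 1 - (j + d + 1 + j) = d by omega]
    zify
    push_cast at c2 c3 c4
    linarith
  rw [show j + d + 1 - 1 - j = d by omega, show j + d - j = d by omega, e1, e2]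
  have s : ((-1) ^ j * (-1) ^ j : ℤ⟦X⟧) = 1 := by rw [← mul_pow]; simp
  simp only [pow_add, pow_one]
  linear_combination (-(-1) ^ d * d * X ^ ((j + d).choose 2) * X ^ ((j + d) * (j + d + 1)) *
    X ^ ((j + 1).choose 2) * qBinomial X (2 * (j + d) + 1) d) * s

/-- The factors beyond the `m`-th are 1 modulo `X^(m+1)`. -/
theorem X_pow_dvd_qFactorial_sub {m M : ℕ} (h : m ≤ M) :
    (X : ℤ⟦X⟧) ^ (m + 1) ∣ qFactorial X M - pentagonalSeries ℤ := by
  have hstep : ∀ d, (X : ℤ⟦X⟧) ^ (m + 1) ∣ qFactorial X (M + d) - qFactorial X M := by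
    intro d
    induction d with
    | zero => simp
    | succ d ih =>
      rw [← add_assoc, qFactorial_succ]
      have : (X : ℤ⟦X⟧) ^ (m + 1) ∣ X ^ (M + d + 1) := pow_dvd_pow _ (by omega)
      convert dvd_sub ih (this.mul_left (qFactorial X (M + d))) using 1
      ring
  rw [X_pow_dvd_iff]
  intro i hi
  obtain ⟨s, hs⟩ := Filter.eventually_atTop.1 (coeff_prod_one_sub_X_pow_eventually_eq ℤ i)
  obtain ⟨d, hd⟩ : ∃ d, s ⊆ Finset.range (M + d) :=
    ⟨s.sup id + 1, fun x hx ↦ Finset.mem_range.2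
      (by have := Finset.le_sup (f := id) hx; simp only [id] at this; omega)⟩
  have h1 := hs _ hd
  have h2 := X_pow_dvd_iff.1 (hstep d) i hi
  rw [map_sub, sub_eq_zero] at h2 ⊢
  rw [← h2, ← h1]
  rfl

/-- All three factorials in the quotient formula are `E` modulo `X^(m+1)`, so the binomial is `1 /
E` there. -/
theorem X_pow_dvd_qBinomial_mul_sub_one {m a b : ℕ} (ha : m ≤ a) (hb : m ≤ b) :
    (X : ℤ⟦X⟧) ^ (m + 1) ∣ qBinomial X (a + b) a * pentagonalSeries ℤ - 1 := by
  have h := qBinomial_mul_qFactorial (X : ℤ⟦X⟧) a b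
  have h0 := partitionSeries_mul_pentagonalSeries
  set E := pentagonalSeries ℤ
  have key : qBinomial X (a + b) a * E - 1 = partitionSeries * ((qFactorial X (a + b) - E) -
      qBinomial X (a + b) a * (E * (qFactorial X a - E) +
        qFactorial X a * (qFactorial X b - E))) := by
    linear_combination (1 - qBinomial X (a + b) a * E) * h0 + partitionSeries * h
  rw [key]
  exact (((X_pow_dvd_qFactorial_sub (by omega)).sub (((X_pow_dvd_qFactorial_sub ha).mul_left _).add
    ((X_pow_dvd_qFactorial_sub hb).mul_left _) |>.mul_left _))).mul_left _

/-- Multiply the formula for `qFactorial X n ^ 2` by `E`: both binomials become 1 to the required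
order, leaving `(n + 1 + j) - (n - j) = 2j + 1`. -/
theorem X_pow_dvd_pentagonalSeries_cube_sub (n : ℕ) :
    (X : ℤ⟦X⟧) ^ (n + 1) ∣ pentagonalSeries ℤ ^ 3 -
      ∑ j ∈ Finset.range (n + 1), C ((-1) ^ j * (2 * (j : ℤ) + 1)) * X ^ ((j + 1).choose 2) := by
  have h := qFactorial_sq_eq_sum n
  set E := pentagonalSeries ℤ with hE
  have h1 : E ^ 3 - ∑ j ∈ Finset.range (n + 1), C ((-1) ^ j * (2 * (j : ℤ) + 1)) *
      X ^ ((j + 1).choose 2) = -(E * (qFactorial X n + E) * (qFactorial X n - E)) +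
      (E * qFactorial X n ^ 2 - ∑ j ∈ Finset.range (n + 1), C ((-1) ^ j * (2 * (j : ℤ) + 1)) *
      X ^ ((j + 1).choose 2)) := by ring
  rw [h1, h, Finset.mul_sum, ← Finset.sum_sub_distrib]
  refine dvd_add ((X_pow_dvd_qFactorial_sub le_rfl).mul_left _).neg_right
    (Finset.dvd_sum fun j hj ↦ ?_)
  obtain ⟨d, rfl⟩ := Nat.exists_eq_add_of_le (Nat.lt_succ_iff.1 (Finset.mem_range.1 hj))
  have d1 := X_pow_dvd_qBinomial_mul_sub_one (a := d) (b := j + d + 1 + j)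
    (le_refl d) (by omega)
  have d2 := X_pow_dvd_qBinomial_mul_sub_one (a := j + d + 1 + j) (b := d)
    (by omega) (le_refl d)
  rw [show d + (j + d + 1 + j) = 2 * (j + d) + 1 by ring, ← hE] at d1
  rw [show j + d + 1 + j + d = 2 * (j + d) + 1 by ring, ← hE] at d2
  -- The binomials are known only modulo `X^(d+1)`, `d = n - j`; the triangular power supplies the
  -- missing `j`.
  have hT : j ≤ (j + 1).choose 2 := by
    rw [Nat.choose_succ_succ' j 1, Nat.choose_one_right]; omega
  have d3 : (X : ℤ⟦X⟧) ^ (j + d + 1) ∣ X ^ ((j + 1).choose 2) * X ^ (d + 1) := by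
    rw [← pow_add]; exact pow_dvd_pow _ (by omega)
  refine (d3.trans (mul_dvd_mul_left _ ((d2.mul_left ((j + d + 1 + j : ℕ) : ℤ⟦X⟧)).sub
    (d1.mul_left (d : ℤ⟦X⟧))))).trans (Dvd.intro_left ((-1) ^ j) ?_)
  rw [show j + d - j = d by omega]
  simp
  ring

/-- **Jacobi's identity** for the cube of the Euler product. -/
theorem coeff_pentagonalSeries_cube (n : ℕ) :
    (pentagonalSeries ℤ ^ 3).coeff n = ∑ j ∈ Finset.range (n + 1),
      if n = (j + 1).choose 2 then (-1) ^ j * (2 * (j : ℤ) + 1) else 0 := by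
  have h := X_pow_dvd_iff.1 (X_pow_dvd_pentagonalSeries_cube_sub n) n (Nat.lt_succ_self n)
  rw [map_sub, sub_eq_zero] at h
  rw [h, map_sum]
  refine Finset.sum_congr rfl fun j _ ↦ ?_
  rw [coeff_C_mul, coeff_X_pow, mul_ite, mul_one, mul_zero]

end JacobiTriangular

/-! ### Supports of series modulo `d`, and 25th powers -/

open PowerSeries

/-- The coefficients of `f` at the exponents outside `p` are divisible by `d`. -/
def DvdCoeffOff (d : ℤ) (p : ℕ → Prop) (f : ℤ⟦X⟧) : Prop :=
  ∀ n, ¬ p n → d ∣ f.coeff n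

namespace DvdCoeffOff

variable {d : ℤ} {p q r : ℕ → Prop} {f g : ℤ⟦X⟧}

theorem mul (hf : DvdCoeffOff d p f) (hg : DvdCoeffOff d q g)
    (h : ∀ a b, p a → q b → r (a + b)) : DvdCoeffOff d r (f * g) := by
  intro n hn
  rw [coeff_mul]
  refine Finset.dvd_sum fun x hx ↦ ?_
  rw [Finset.HasAntidiagonal.mem_antidiagonal] at hx
  by_cases hp : p x.1
  · have hq : ¬ q x.2 := fun hq ↦ hn (hx ▸ h _ _ hp hq)
    exact (hg _ hq).mul_left _
  · exact (hf _ hp).mul_right _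

theorem add (hf : DvdCoeffOff d p f) (hg : DvdCoeffOff d p g) : DvdCoeffOff d p (f + g) :=
  fun n hn ↦ by rw [map_add]; exact (hf n hn).add (hg n hn)

theorem neg (hf : DvdCoeffOff d p f) : DvdCoeffOff d p (-f) :=
  fun n hn ↦ by rw [map_neg]; exact (hf n hn).neg_right

theorem mono (hf : DvdCoeffOff d p f) (h : ∀ n, p n → q n) : DvdCoeffOff d q f :=
  fun n hn ↦ hf n fun hp ↦ hn (h n hp)

/-- With `e = 0`, exact vanishing off `p` gives divisibility by any `d`. -/
theorem of_dvd {e : ℤ} (hf : DvdCoeffOff e p f) (h : d ∣ e) : DvdCoeffOff d p f :=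
  fun n hn ↦ h.trans (hf n hn)

theorem C_mul (c : ℤ) (hf : DvdCoeffOff d p f) : DvdCoeffOff (c * d) p (C c * f) :=
  fun n hn ↦ by rw [coeff_C_mul]; exact mul_dvd_mul_left _ (hf n hn)

theorem C_self_mul (f : ℤ⟦X⟧) (p : ℕ → Prop) : DvdCoeffOff d p (C d * f) :=
  fun n _ ↦ by rw [coeff_C_mul]; exact dvd_mul_right _ _

end DvdCoeffOff

/-- Modulo `5`, a fifth power is a series in `X ^ 5`. -/
theorem exists_pow_five_eq (f : ℤ⟦X⟧) :
    ∃ g, f ^ 5 = expand 5 (by norm_num) f + C 5 * g := by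
  have h5 : (5 : ℕ) ≠ 0 := by norm_num
  have : Fact (Nat.Prime 5) := ⟨by norm_num⟩
  have h : PowerSeries.map (Int.castRingHom (ZMod 5)) (f ^ 5) =
      PowerSeries.map (Int.castRingHom (ZMod 5)) (expand 5 h5 f) := by
    rw [map_expand, map_pow]
    -- Frobenius is the identity on `ZMod 5`, so the fifth power is just `expand 5`.
    have := MvPowerSeries.map_frobenius_expand (R := ZMod 5) (p := 5) h5
      (f := PowerSeries.map (Int.castRingHom (ZMod 5)) f)
    rw [ZMod.frobenius_zmod] at this
    rw [← this]
    exact congrFun (congrArg DFunLike.coe MvPowerSeries.map_id) _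
  have hd : ∀ n, (5 : ℤ) ∣ (f ^ 5 - expand 5 h5 f).coeff n := by
    intro n
    have h1 := congrArg (coeff n) h
    rw [coeff_map, coeff_map] at h1
    rw [map_sub]
    exact (ZMod.intCast_eq_intCast_iff_dvd_sub _ _ 5).1 h1.symm
  refine ⟨PowerSeries.mk fun n ↦ (f ^ 5 - expand 5 h5 f).coeff n / 5, ?_⟩
  rw [← sub_eq_iff_eq_add']
  ext n
  rw [coeff_C_mul, coeff_mk, Int.mul_ediv_cancel' (hd n)]

theorem dvdCoeffOff_expand (f : ℤ⟦X⟧) (d : ℤ) :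
    DvdCoeffOff d (fun n ↦ n % 5 = 0) (expand 5 (by norm_num) f) := by
  intro n hn
  rw [coeff_expand_of_not_dvd _ _ _ (by omega)]
  exact dvd_zero d

theorem dvdCoeffOff_pow_twentyFive (f : ℤ⟦X⟧) :
    DvdCoeffOff 25 (fun n ↦ n % 5 = 0) (f ^ 25) := by
  obtain ⟨g, hg⟩ := exists_pow_five_eq f
  set u := expand 5 (by norm_num) f
  -- Binomial expansion of `(u + 5g)^5`: every term after `u^5` is divisible by 25.
  have h : f ^ 25 = expand 5 (by norm_num) (f ^ 5) + C 25 * (u ^ 4 * g + 10 * u ^ 3 * g ^ 2 +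
      50 * u ^ 2 * g ^ 3 + 125 * u * g ^ 4 + 125 * g ^ 5) := by
    rw [map_pow, show f ^ 25 = (f ^ 5) ^ 5 by ring, hg, map_ofNat C 5, map_ofNat C 25]
    ring
  rw [h]
  exact (dvdCoeffOff_expand _ _).add (DvdCoeffOff.C_self_mul _ _)

/-- Applying the fifth-power congruence twice gives `f^25 ≡ f(X^25)` modulo 5. -/
theorem dvdCoeffOff_five_pow_twentyFive (f : ℤ⟦X⟧) :
    DvdCoeffOff 5 (fun n ↦ n % 25 = 0) (f ^ 25) := by
  obtain ⟨g, hg⟩ := exists_pow_five_eq (f ^ 5)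
  obtain ⟨g', hg'⟩ := exists_pow_five_eq f
  rw [show f ^ 25 = (f ^ 5) ^ 5 by ring, hg, hg', map_add, map_mul, ← expand_mul, expand_C]
  refine DvdCoeffOff.add (DvdCoeffOff.add ?_ (DvdCoeffOff.C_self_mul _ _))
    (DvdCoeffOff.C_self_mul _ _)
  intro n hn
  rw [coeff_expand_of_not_dvd _ _ _ (by omega)]
  exact dvd_zero _

/-! ### Residues of pentagonal and triangular exponents; 5-dissections -/

/-- Since `24n + 1 = (6k - 1)^2`, the class `k ≡ 1` mod 5 makes this square divisible by 25. -/
theorem mod_of_coeff_pentagonalSeries_ne_zero {n : ℕ}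
    (h : (pentagonalSeries ℤ).coeff n ≠ 0) : n % 5 = 0 ∨ n % 25 = 1 ∨ n % 5 = 2 := by
  obtain ⟨k, rfl⟩ : n ∈ Set.range pentagonal := by
    by_contra hn
    exact h (coeff_pentagonalSeries_eq_zero ℤ hn)
  have hk := two_mul_natCast_pentagonal k
  obtain ⟨m, c, hc0, hc5, rfl⟩ : ∃ m c : ℤ, 0 ≤ c ∧ c < 5 ∧ k = 5 * m + c :=
    ⟨k / 5, k % 5, by omega, by omega, by omega⟩
  generalize pentagonal (5 * m + c) = n at *
  have h1 : (5 * m + c) * (3 * (5 * m + c) - 1) =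
      75 * (m * m) + (30 * c - 5) * m + c * (3 * c - 1) := by ring
  rw [h1] at hk
  generalize m * m = w at hk
  interval_cases c <;> omega

/-- Since `8n + 1 = (2j + 1)^2`, the class `j ≡ 2` mod 5 gives both the factor 5 and `n ≡ 3` mod 25.
-/
theorem triangular_mod {n j : ℕ} (h : n = (j + 1).choose 2) :
    n % 5 = 0 ∨ n % 5 = 1 ∨ n % 25 = 3 ∧ (5 : ℤ) ∣ 2 * j + 1 := by
  have hj := two_mul_choose_two (j + 1)
  rw [← h] at hj
  push_cast at hj
  obtain ⟨m, c, hc5, rfl⟩ : ∃ m c : ℕ, c < 5 ∧ j = 5 * m + c :=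
    ⟨j / 5, j % 5, by omega, by omega⟩
  push_cast at hj ⊢
  have h1 : (5 * (m : ℤ) + c + 1) * (5 * m + c + 1 - 1) =
      25 * (m * m) + (10 * c + 5) * m + c * (c + 1) := by ring
  rw [h1] at hj
  generalize (m : ℤ) * m = w at hj
  interval_cases c <;> push_cast at hj ⊢ <;> omega

theorem coeff_pentagonalSeries_cube_eq_zero {n : ℕ} (h0 : n % 5 ≠ 0) (h1 : n % 5 ≠ 1)
    (h3 : n % 25 ≠ 3) : (pentagonalSeries ℤ ^ 3).coeff n = 0 := by
  rw [coeff_pentagonalSeries_cube]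
  refine Finset.sum_eq_zero fun j _ ↦ if_neg fun h ↦ ?_
  rcases triangular_mod h with h | h | h
  exacts [h0 h, h1 h, h3 h.1]

theorem five_dvd_coeff_pentagonalSeries_cube {n : ℕ} (h : n % 5 = 3) :
    5 ∣ (pentagonalSeries ℤ ^ 3).coeff n := by
  rw [coeff_pentagonalSeries_cube]
  refine Finset.dvd_sum fun j _ ↦ ?_
  split_ifs with hj
  · rcases triangular_mod hj with h' | h' | h'
    · omega
    · omega
    · exact h'.2.mul_left _
  · exact dvd_zero _

/-- A 5-dissection of the Euler product. -/
theorem exists_pentagonalSeries_eq_add : ∃ a b : ℤ⟦X⟧, pentagonalSeries ℤ = a + b ∧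
    DvdCoeffOff 0 (fun n ↦ n % 5 = 0 ∨ n % 5 = 2) a ∧ DvdCoeffOff 0 (fun n ↦ n % 25 = 1) b := by
  refine ⟨.mk fun n ↦ if n % 5 = 1 then 0 else (pentagonalSeries ℤ).coeff n,
    .mk fun n ↦ if n % 5 = 1 then (pentagonalSeries ℤ).coeff n else 0, ?_, ?_, ?_⟩
  · ext n
    rw [map_add, coeff_mk, coeff_mk]
    split_ifs <;> simp
  all_goals
    intro n hn
    rw [coeff_mk, zero_dvd_iff]
    by_contra hne
    have h := mod_of_coeff_pentagonalSeries_ne_zero (n := n) (by intro h; simp [h] at hne)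
    have h' : n % 5 = 1 ↔ n % 25 = 1 := by omega
    by_cases h1 : n % 5 = 1
    · simp_all
    · simp_all

/-- A 5-dissection of the cube of the Euler product. -/
theorem exists_pentagonalSeries_cube_eq_add : ∃ a b c : ℤ⟦X⟧,
    pentagonalSeries ℤ ^ 3 = a + b + C 5 * c ∧ DvdCoeffOff 0 (fun n ↦ n % 5 = 0) a ∧
    DvdCoeffOff 0 (fun n ↦ n % 5 = 1) b ∧ DvdCoeffOff 0 (fun n ↦ n % 25 = 3) c := by
  refine ⟨.mk fun n ↦ if n % 5 = 0 then (pentagonalSeries ℤ ^ 3).coeff n else 0,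
    .mk fun n ↦ if n % 5 = 1 then (pentagonalSeries ℤ ^ 3).coeff n else 0,
    .mk fun n ↦ if n % 5 = 3 then (pentagonalSeries ℤ ^ 3).coeff n / 5 else 0, ?_, ?_, ?_, ?_⟩
  · ext n
    rw [map_add, map_add, coeff_C_mul, coeff_mk, coeff_mk, coeff_mk]
    by_cases h0 : n % 5 = 0
    · simp [h0]
    by_cases h1 : n % 5 = 1
    · simp [h1]
    by_cases h3 : n % 5 = 3
    · simp [h3, Int.mul_ediv_cancel' (five_dvd_coeff_pentagonalSeries_cube h3)]
    · rw [coeff_pentagonalSeries_cube_eq_zero h0 h1 (by omega)]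
      simp [h0, h1, h3]
  · intro n hn
    simp [hn]
  · intro n hn
    simp [hn]
  · intro n hn
    rw [coeff_mk]
    split_ifs with h
    · rw [coeff_pentagonalSeries_cube_eq_zero (by omega) (by omega) hn]
      simp
    · simp

/-! ### The congruences modulo 25 -/

/-- To get rid of negative powers of the Euler product, complete the exponent to a multiple of
`25`. -/
theorem coloredPartitionCount_modEq_zero {k s l n : ℕ} {p : ℕ → Prop} (hs : k + l = 25 * s)
    (h : DvdCoeffOff 25 p (pentagonalSeries ℤ ^ l * (partitionSeries ^ s) ^ 25)) (hn : ¬ p n) :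
    coloredPartitionCount k n ≡ 0 [MOD 25] := by
  rw [Nat.modEq_zero_iff_dvd]
  have h1 := h n hn
  rw [← pow_mul, mul_comm s, ← hs, pow_add, mul_left_comm, ← mul_pow,
    mul_comm (pentagonalSeries ℤ), partitionSeries_mul_pentagonalSeries, one_pow, mul_one,
    coeff_partitionSeries_pow] at h1
  exact_mod_cast h1

theorem DvdCoeffOff.C_five_mul {p : ℕ → Prop} {f : ℤ⟦X⟧} (hf : DvdCoeffOff 5 p f) :
    DvdCoeffOff 25 p (C 5 * f) :=
  hf.C_mul 5

/-- The factor 5 on `c` means `h^25` matters there only modulo 5, so the class 3 mod 25 is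
preserved. -/
theorem dvdCoeffOff_pentagonalSeries_cube_mul (h : ℤ⟦X⟧) :
    DvdCoeffOff 25 (fun n ↦ n % 5 = 0 ∨ n % 5 = 1 ∨ n % 25 = 3)
      (pentagonalSeries ℤ ^ 3 * h ^ 25) := by
  obtain ⟨a, b, c, he, ha, hb, hc⟩ := exists_pentagonalSeries_cube_eq_add
  have h5 := dvdCoeffOff_pow_twentyFive h
  have h25 := dvdCoeffOff_five_pow_twentyFive h
  have e : pentagonalSeries ℤ ^ 3 * h ^ 25 = a * h ^ 25 + b * h ^ 25 + C 5 * (c * h ^ 25) := by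
    rw [he]; ring
  rw [e]
  refine .add (.add ?_ ?_) ?_
  · exact (ha.of_dvd (dvd_zero _)).mul h5 (by omega)
  · exact (hb.of_dvd (dvd_zero _)).mul h5 (by omega)
  · exact ((hc.of_dvd (dvd_zero _)).mul h25 (by omega)).C_five_mul

/-- Only `5vc` reaches 4 mod 5, with exponents `1 + 3` mod 25. -/
theorem dvdCoeffOff_pentagonalSeries_pow_four_mul (h : ℤ⟦X⟧) :
    DvdCoeffOff 25 (fun n ↦ n % 5 ≠ 4 ∨ n % 25 = 4) (pentagonalSeries ℤ ^ 4 * h ^ 25) := by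
  obtain ⟨a, b, c, he, ha, hb, hc⟩ := exists_pentagonalSeries_cube_eq_add
  obtain ⟨u, v, he', hu, hv⟩ := exists_pentagonalSeries_eq_add
  have h5 := dvdCoeffOff_pow_twentyFive h
  have h25 := dvdCoeffOff_five_pow_twentyFive h
  have e : pentagonalSeries ℤ ^ 4 * h ^ 25 = u * (a + b) * h ^ 25 + v * (a + b) * h ^ 25 +
      C 5 * (u * c) * h ^ 25 + C 5 * (v * c * h ^ 25) := by
    rw [pow_succ, he, he']; ring
  have hab : DvdCoeffOff 0 (fun n ↦ n % 5 = 0 ∨ n % 5 = 1) (a + b) :=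
    (ha.mono fun _ ↦ Or.inl).add (hb.mono fun _ ↦ Or.inr)
  have huc : DvdCoeffOff 0 (fun n ↦ n % 5 = 0 ∨ n % 5 = 3) (u * c) := hu.mul hc (by omega)
  have hvc : DvdCoeffOff 0 (fun n ↦ n % 25 = 4) (v * c) := hv.mul hc (by omega)
  have huab : DvdCoeffOff 0 (fun n ↦ n % 5 ≠ 4) (u * (a + b)) := hu.mul hab (by omega)
  have hvab : DvdCoeffOff 0 (fun n ↦ n % 5 ≠ 4) (v * (a + b)) := hv.mul hab (by omega)
  rw [e]
  refine .add (.add (.add ?_ ?_) ?_) ?_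
  · exact (huab.of_dvd (dvd_zero _)).mul h5 (by omega)
  · exact (hvab.of_dvd (dvd_zero _)).mul h5 (by omega)
  · exact ((huc.of_dvd (dvd_zero 5)).C_five_mul).mul h5 (by omega)
  · exact ((hvc.of_dvd (dvd_zero _)).mul h25 (by omega)).C_five_mul

/-- Modulo `5`, compare the square of the cube of the Euler product with its sixth power. -/
theorem dvdCoeffOff_two_mul_mul {a b c : ℤ⟦X⟧} (he : pentagonalSeries ℤ ^ 3 = a + b + C 5 * c)
    (ha : DvdCoeffOff 0 (fun n ↦ n % 5 = 0) a) (hb : DvdCoeffOff 0 (fun n ↦ n % 5 = 1) b) :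
    DvdCoeffOff 5 (fun n ↦ n % 25 = 1 ∨ n % 25 = 6 ∨ n % 25 = 11) (C 2 * (a * b)) := by
  obtain ⟨u, v, he', hu, hv⟩ := exists_pentagonalSeries_eq_add
  obtain ⟨g, hg⟩ := exists_pow_five_eq (pentagonalSeries ℤ)
  -- The exponents are five times pentagonal numbers, which are 0, 1 or 2 mod 5.
  have hx : DvdCoeffOff 0 (fun n ↦ n % 25 = 0 ∨ n % 25 = 5 ∨ n % 25 = 10)
      (expand 5 (by norm_num) (pentagonalSeries ℤ)) := by
    intro n hn
    rw [coeff_expand, zero_dvd_iff]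
    split_ifs with hd
    · by_contra h
      have := mod_of_coeff_pentagonalSeries_ne_zero h
      omega
    · rfl
  set w := expand 5 (by norm_num) (pentagonalSeries ℤ)
  -- From `(E^3)^2 = E * E^5`; apart from multiples of 5, only `v * w` meets the class 1 mod 5.
  have e : C 2 * (a * b) = v * w + (u * w + -(a * a) + -(b * b)) +
      C 5 * (pentagonalSeries ℤ * g - C 2 * (a + b) * c - C 5 * c ^ 2) := by
    have h6 : (pentagonalSeries ℤ ^ 3) ^ 2 = (u + v) * w + C 5 * (pentagonalSeries ℤ * g) := by
      rw [← he']
      linear_combination pentagonalSeries ℤ * hg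
    rw [he] at h6
    rw [map_ofNat C 2]
    linear_combination h6
  have hab : DvdCoeffOff 0 (fun n ↦ n % 5 = 1) (C 2 * (a * b)) :=
    (ha.mul hb (by omega)).C_mul 2
  have hvw : DvdCoeffOff 0 (fun n ↦ n % 25 = 1 ∨ n % 25 = 6 ∨ n % 25 = 11) (v * w) :=
    hv.mul hx (by omega)
  have haux : DvdCoeffOff 0 (fun n ↦ n % 5 ≠ 1) (u * w + -(a * a) + -(b * b)) :=
    ((hu.mul hx (by omega)).add (ha.mul ha (by omega)).neg).add (hb.mul hb (by omega)).neg
  intro n hn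
  by_cases h1 : n % 5 = 1
  · rw [e, map_add, map_add]
    exact (((dvd_zero 5).trans (hvw n hn)).add ((dvd_zero 5).trans (haux n (by simpa using h1)))).add
      (DvdCoeffOff.C_self_mul _ (fun _ ↦ False) n not_false)
  · exact (dvd_zero 5).trans (hab n h1)

/-- Expanding the cube of `(a + b) + 5c`, only the cross term `2ab` of `15 * (a + b)^2 * c` reaches
4 mod 5 modulo 25; adding 3 to 1, 6, 11 leaves 4, 9, 14 mod 25. -/
theorem dvdCoeffOff_pentagonalSeries_pow_nine_mul (h : ℤ⟦X⟧) :
    DvdCoeffOff 25 (fun n ↦ n % 25 ≠ 19 ∧ n % 25 ≠ 24) (pentagonalSeries ℤ ^ 9 * h ^ 25) := by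
  obtain ⟨a, b, c, he, ha, hb, hc⟩ := exists_pentagonalSeries_cube_eq_add
  have h5 := dvdCoeffOff_pow_twentyFive h
  have h25 := dvdCoeffOff_five_pow_twentyFive h
  have h2ab := dvdCoeffOff_two_mul_mul he ha hb
  have e : pentagonalSeries ℤ ^ 9 * h ^ 25 = (a + b) * ((a + b) * (a + b)) * h ^ 25 +
      C 5 * (C 3 * ((a * a + b * b) * c)) * h ^ 25 +
      C 25 * ((C 3 * (a + b) * c ^ 2 + C 5 * c ^ 3) * h ^ 25) +
      C 5 * (C 3 * (C 2 * (a * b) * c * h ^ 25)) := by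
    rw [show pentagonalSeries ℤ ^ 9 = (pentagonalSeries ℤ ^ 3) ^ 3 by ring, he]
    simp only [map_ofNat]
    ring
  have hab : DvdCoeffOff 0 (fun n ↦ n % 5 = 0 ∨ n % 5 = 1) (a + b) :=
    (ha.mono fun _ ↦ Or.inl).add (hb.mono fun _ ↦ Or.inr)
  have hab2 : DvdCoeffOff 0 (fun n ↦ n % 5 = 0 ∨ n % 5 = 1 ∨ n % 5 = 2) ((a + b) * (a + b)) :=
    hab.mul hab (by omega)
  have hab3 : DvdCoeffOff 0 (fun n ↦ n % 5 ≠ 4) ((a + b) * ((a + b) * (a + b))) :=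
    hab.mul hab2 (by omega)
  have hsq : DvdCoeffOff 0 (fun n ↦ n % 5 = 0 ∨ n % 5 = 2) (a * a + b * b) :=
    (ha.mul ha (by omega)).add (hb.mul hb (by omega))
  have hsqc : DvdCoeffOff 0 (fun n ↦ n % 5 ≠ 4) (C 3 * ((a * a + b * b) * c)) :=
    (hsq.mul hc (by omega)).C_mul 3
  have habc : DvdCoeffOff 5 (fun n ↦ n % 25 = 4 ∨ n % 25 = 9 ∨ n % 25 = 14)
      (C 2 * (a * b) * c) := h2ab.mul (hc.of_dvd (dvd_zero _)) (by omega)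
  rw [e]
  refine .add (.add (.add ?_ ?_) (.C_self_mul _ _)) ?_
  · exact (hab3.of_dvd (dvd_zero _)).mul h5 (by omega)
  · exact ((hsqc.of_dvd (dvd_zero 5)).C_five_mul).mul h5 (by omega)
  · exact (((habc.mul h25 (by omega)).C_mul 3).of_dvd (by norm_num)).C_five_mul

theorem corollary3p2 (r n : ℕ) :
    (coloredPartitionCount (25 * r + 16) (25 * n + 19) ≡ 0 [MOD 25] ∧
      coloredPartitionCount (25 * r + 16) (25 * n + 24) ≡ 0 [MOD 25]) ∧
    (coloredPartitionCount (25 * r + 21) (25 * n + 9) ≡ 0 [MOD 25] ∧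
      coloredPartitionCount (25 * r + 21) (25 * n + 14) ≡ 0 [MOD 25] ∧
      coloredPartitionCount (25 * r + 21) (25 * n + 19) ≡ 0 [MOD 25] ∧
      coloredPartitionCount (25 * r + 21) (25 * n + 24) ≡ 0 [MOD 25]) ∧
    (coloredPartitionCount (25 * r + 22) (25 * n + 8) ≡ 0 [MOD 25] ∧
      coloredPartitionCount (25 * r + 22) (25 * n + 13) ≡ 0 [MOD 25] ∧
      coloredPartitionCount (25 * r + 22) (25 * n + 18) ≡ 0 [MOD 25] ∧
      coloredPartitionCount (25 * r + 22) (25 * n + 23) ≡ 0 [MOD 25]) := by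
  have h16 : 25 * r + 16 + 9 = 25 * (r + 1) := by ring
  have h21 : 25 * r + 21 + 4 = 25 * (r + 1) := by ring
  have h22 : 25 * r + 22 + 3 = 25 * (r + 1) := by ring
  refine ⟨⟨?_, ?_⟩, ⟨?_, ?_, ?_, ?_⟩, ⟨?_, ?_, ?_, ?_⟩⟩
  any_goals
    exact coloredPartitionCount_modEq_zero h16
      (dvdCoeffOff_pentagonalSeries_pow_nine_mul _) (by omega)
  any_goals
    exact coloredPartitionCount_modEq_zero h21
      (dvdCoeffOff_pentagonalSeries_pow_four_mul _) (by omega)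
  any_goals
    exact coloredPartitionCount_modEq_zero h22
      (dvdCoeffOff_pentagonalSeries_cube_mul _) (by omega)
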